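/- There are absolute constants $C, C', q > 0$ such that the following holds for all integers $n \ge 0$ and $1 \le k \le d$ and all reals $p \ge 1$, $0<\varepsilon<1$, $0\le\alpha\le 1$. Let $x_1,\dots,x_n\in\mathbb{R}^d$. For a linear subspace $V\subseteq\mathbb{R}^d$ let $d(x,V)$ be the Euclidean distance, and let $N_\alpha(V)\subseteq[n]$ denote a set of indices of the $\lceil(1-\alpha)n\rceil$ points nearest to $V$ (ties broken arbitrarily). Let $V^*$ be a $k$-dimensional linear subspace that minimizes $\sum_{i\in N_\alpha(V)}d(x_i,V)^p$ over all $k$-dimensional linear subspaces $V$, and let $I=N_\alpha(V^*)$ be its set of inliers. Put $N=\lceil C\,\frac{p^2k}{\varepsilon^2}\log\frac{2k}{\varepsilon}\rceil$ and draw index sets $S_1,\dots,S_k\subseteq[n]$ in $k$ rounds: given $S_1,\dots,S_{t-1}$, the set $S_t$ consists of $N$ i.i.d. indices, each equal to $i$ with probability proportional to $d\bigl(x_i,\operatorname{span}\{x_j: j\in S_1\cup\dots\cup S_{t-1}\}\bigr)^p$ (so proportional to $\|x_i\|^p$ in the first round); if all these distances are $0$, then $S_t=\emptyset$. Let $S=S_1\cup\dots\cup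 S_k$. The total number of points drawn is at most $kN\le C'\,\frac{p^2k^2}{\varepsilon^2}\log\frac{2k}{\varepsilon}$. With probability at least $q$, the space $\operatorname{span}\{x_i: i\in S\}$ contains a linear subspace $V_S$ of dimension $\min\{k,\dim\operatorname{span}\{x_1,\dots,x_n\}\}$ (thus of dimension $k$ as soon as the points span at least $k$ dimensions) such that $$\sum_{i\in I}d(x_i,V_S)^p\;\le\;\sum_{i\in I}d(x_i,V^*)^p+\varepsilon\sum_{i=1}^n\|x_i\|^p .$$ -/

import Mathlib

noncomputable section

namespace SubspaceOutliers

/-- Euclidean space of dimension `d`. -/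
abbrev Pt (d : ℕ) : Type := EuclideanSpace ℝ (Fin d)

variable {n d : ℕ}

/-- Euclidean distance from a point to a linear subspace. -/
def distTo (y : Pt d) (V : Submodule ℝ (Pt d)) : ℝ :=
  Metric.infDist y (V : Set (Pt d))

/-- The linear span of the points `x i` with `i ∈ S`. -/
def spanOf (x : Fin n → Pt d) (S : Finset (Fin n)) : Submodule ℝ (Pt d) :=
  Submodule.span ℝ (x '' (S : Set (Fin n)))

/-- The `ℓ_p` error of the subspace `V`, summed over the points with index in `I`. -/
def lpError (x : Fin n → Pt d) (p : ℝ) (V : Submodule ℝ (Pt d)) (I : Finset (Fin n)) : ℝ :=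
  ∑ i ∈ I, distTo (x i) V ^ p

/-- `I` consists of the indices of the `(1 - α) n` points (rounded up to an integer) that are
nearest to `V`; ties may be broken in any way. -/
def IsNearest (x : Fin n → Pt d) (α : ℝ) (V : Submodule ℝ (Pt d)) (I : Finset (Fin n)) : Prop :=
  I.card = ⌈(1 - α) * (n : ℝ)⌉₊ ∧ ∀ i ∈ I, ∀ j, j ∉ I → distTo (x i) V ≤ distTo (x j) V

/-- `V` is an optimal `k`-dimensional subspace for `ℓ_p` subspace approximation with outlier
parameter `α`, and `I` is its set of inliers. -/
structure IsOptimal (x : Fin n → Pt d) (k : ℕ) (p α : ℝ) (V : Submodule ℝ (Pt d))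
    (I : Finset (Fin n)) : Prop where
  finrank_eq : Module.finrank ℝ V = k
  nearest : IsNearest x α V I
  le_error : ∀ (V' : Submodule ℝ (Pt d)) (I' : Finset (Fin n)),
    Module.finrank ℝ V' = k → IsNearest x α V' I' → lpError x p V I ≤ lpError x p V' I'

/-- The law of `N` independent draws from `q`. -/
def iid {ι : Type} [Fintype ι] (q : PMF ι) (N : ℕ) : PMF (Fin N → ι) :=
  PMF.ofFintype (fun f => ∏ j, q (f j)) (by
    classical
    have h : ∑ i, q i = 1 := by simpa [tsum_fintype] using q.tsum_coe
    have h2 := Finset.prod_univ_sum (fun _ : Fin N => (Finset.univ : Finset ι))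
      (fun _ i => q i)
    rw [Fintype.piFinset_univ] at h2
    rw [← h2]
    simp [h])

/-- The unnormalized weight of index `i` when `S` has been sampled: the `p`-th power of the
distance of `x i` to the span of the sample. -/
def weight (x : Fin n → Pt d) (p : ℝ) (S : Finset (Fin n)) (i : Fin n) : ENNReal :=
  ENNReal.ofReal (distTo (x i) (spanOf x S) ^ p)

theorem tsum_weight_ne_top (x : Fin n → Pt d) (p : ℝ) (S : Finset (Fin n)) :
    ∑' i, weight x p S i ≠ ⊤ := by
  rw [tsum_fintype]
  exact ENNReal.sum_ne_top.mpr fun i _ => ENNReal.ofReal_ne_top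

open Classical in
/-- One round: `N` i.i.d. indices, each drawn with probability proportional to `weight x p S`,
are added to `S`. If all weights vanish (every point lies in the span of the sample already),
nothing is added. -/
def round (x : Fin n → Pt d) (p : ℝ) (N : ℕ) (S : Finset (Fin n)) : PMF (Finset (Fin n)) :=
  if h : ∑' i, weight x p S i = 0 then PMF.pure S
  else (iid (PMF.normalize (weight x p S) h (tsum_weight_ne_top x p S)) N).map
    (fun f => S ∪ Finset.univ.image f)

/-- The law of the set of indices sampled in the first `t` adaptive rounds. In the first round
the span is `0`, so that the weights are `‖x i‖ ^ p`. -/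
def adaptiveSample (x : Fin n → Pt d) (p : ℝ) (N : ℕ) : ℕ → PMF (Finset (Fin n))
  | 0 => PMF.pure ∅
  | t + 1 => (adaptiveSample x p N t).bind (round x p N)

/-- The number of points drawn in each round, with constant `C`. -/
def roundSize (C p : ℝ) (k : ℕ) (ε : ℝ) : ℕ :=
  ⌈C * (p ^ 2 * k / ε ^ 2 * Real.log (2 * k / ε))⌉₊

/-- The sampled set `S` is good for `(V, I)`: the span of the sample contains a subspace of
dimension `k` (or the span of all points, if that has smaller dimension) whose error over `I`
exceeds that of `V` by at most `ε ∑ i, ‖x i‖ ^ p`. -/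
def IsGood (x : Fin n → Pt d) (k : ℕ) (p ε : ℝ) (V : Submodule ℝ (Pt d))
    (I S : Finset (Fin n)) : Prop :=
  ∃ W : Submodule ℝ (Pt d), W ≤ spanOf x S ∧
    Module.finrank ℝ W = min k (Module.finrank ℝ (Submodule.span ℝ (Set.range x))) ∧
    lpError x p W I ≤ lpError x p V I + ε * ∑ i, ‖x i‖ ^ p

end SubspaceOutliers

end

noncomputable section

namespace SubspaceOutliers

variable {n d : ℕ}

/-! Let `H` be the span of the current sample and `T = ∑ i, ‖x i‖ ^ p`. The candidate subspace is
the projection of `V` onto `H`; the potential is `residual V H`, which is at most `dim V = k` and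
never grows with `H`. While every subspace of `H` of dimension at most `k` has excess error above `ε
T`, so does the candidate, and then a point drawn with probability `‖x i‖ ^ p / T` lowers the
potential by at least `(ε / p) ^ 2` on average (`residual_drop`, resting on the geometric
`residual_add_sq_le`). By `iid_potential`, `N (ε / p) ^ 2` times the failure probability is at most
`k`, so the first round alone succeeds with probability at least `1/2`
(`round_not_approximates_le`).

Later rounds cannot spoil this success. Each raises the rank of the sample until it is full, so
after `k` rounds there is room to enlarge the subspace to the prescribed dimension, which does not
increase its error. -/

/-! ### Distance to a subspace -/

theorem distTo_nonneg (y : Pt d) (V : Submodule ℝ (Pt d)) : 0 ≤ distTo y V :=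
  Metric.infDist_nonneg

theorem distTo_le {y w : Pt d} {V : Submodule ℝ (Pt d)} (hw : w ∈ V) : distTo y V ≤ ‖y - w‖ := by
  rw [← dist_eq_norm]
  exact Metric.infDist_le_dist_of_mem hw

theorem distTo_le_norm (y : Pt d) (V : Submodule ℝ (Pt d)) : distTo y V ≤ ‖y‖ := by
  simpa using distTo_le (y := y) V.zero_mem

theorem distTo_anti {V W : Submodule ℝ (Pt d)} (h : V ≤ W) (y : Pt d) :
    distTo y W ≤ distTo y V :=
  Metric.infDist_le_infDist_of_subset h ⟨0, V.zero_mem⟩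

theorem distTo_eq_norm (y : Pt d) (V : Submodule ℝ (Pt d)) :
    distTo y V = ‖y - V.starProjection y‖ := by
  rw [V.starProjection_minimal, distTo, Metric.infDist_eq_iInf]
  simp only [dist_eq_norm]
  rfl

theorem distTo_bot (y : Pt d) : distTo y ⊥ = ‖y‖ := by
  simp [distTo]

theorem distTo_eq_zero_iff {y : Pt d} {V : Submodule ℝ (Pt d)} : distTo y V = 0 ↔ y ∈ V := by
  rw [distTo_eq_norm, norm_sub_eq_zero_iff, eq_comm, Submodule.starProjection_eq_self_iff]

/-! ### The potential and its decrease when a point is added -/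

/-- The sum of the squared sines of the principal angles between `V` and `H`. -/
def residual (V H : Submodule ℝ (Pt d)) : ℝ :=
  ∑ j, distTo (stdOrthonormalBasis ℝ V j : Pt d) H ^ 2

theorem residual_nonneg (V H : Submodule ℝ (Pt d)) : 0 ≤ residual V H :=
  Finset.sum_nonneg fun _ _ => sq_nonneg _

theorem residual_anti (V : Submodule ℝ (Pt d)) {H H' : Submodule ℝ (Pt d)} (h : H ≤ H') :
    residual V H' ≤ residual V H :=
  Finset.sum_le_sum fun _ _ => pow_le_pow_left₀ (distTo_nonneg _ _) (distTo_anti h _) 2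

theorem residual_le_finrank (V H : Submodule ℝ (Pt d)) :
    residual V H ≤ Module.finrank ℝ V := by
  calc residual V H ≤ ∑ _j : Fin (Module.finrank ℝ V), (1 : ℝ) := by
        refine Finset.sum_le_sum fun j _ => ?_
        have h1 : ‖(stdOrthonormalBasis ℝ V j : Pt d)‖ = 1 := 
          (stdOrthonormalBasis ℝ V).norm_eq_one j
        have h2 := distTo_le_norm (stdOrthonormalBasis ℝ V j : Pt d) H
        rw [h1] at h2
        exact pow_le_one₀ (distTo_nonneg _ _) h2
    _ = Module.finrank ℝ V := by simp

/-- A vector of `H'` orthogonal to `H` removes its share of each residual. -/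
theorem sq_distTo_add_le {H H' : Submodule ℝ (Pt d)} (hH : H ≤ H') {z : Pt d} (hz : z ∈ H')
    (hzH : z ∈ Hᗮ) (hz0 : z ≠ 0) (u : Pt d) :
    distTo u H' ^ 2 + (inner ℝ u z) ^ 2 / ‖z‖ ^ 2 ≤ distTo u H ^ 2 := by
  have hzn : 0 < ‖z‖ := norm_pos_iff.mpr hz0
  set r := u - H.starProjection u with hr
  have hrz : inner ℝ r z = inner ℝ u z := by
    rw [hr, inner_sub_left,
      Submodule.inner_right_of_mem_orthogonal (H.starProjection_apply_mem u) hzH, sub_zero]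
  set c := inner ℝ u z / ‖z‖ ^ 2 with hc
  -- `c • z` is the component of `r` along `z`, so Pythagoras gives the saving.
  have h1 : distTo u H' ≤ ‖r - c • z‖ := by
    have : H.starProjection u + c • z ∈ H' :=
      H'.add_mem (hH (H.starProjection_apply_mem u)) (H'.smul_mem _ hz)
    refine (distTo_le this).trans_eq ?_
    rw [hr, sub_sub]
  have h2 : ‖r - c • z‖ ^ 2 = ‖r‖ ^ 2 - (inner ℝ u z) ^ 2 / ‖z‖ ^ 2 := by
    rw [norm_sub_sq_real, inner_smul_right, hrz, norm_smul, mul_pow, Real.norm_eq_abs, sq_abs, hc]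
    field_simp
    ring
  have h3 := pow_le_pow_left₀ (distTo_nonneg u H') h1 2
  rw [distTo_eq_norm u H, ← hr]
  linarith

theorem sum_sq_inner_stdOrthonormalBasis (V : Submodule ℝ (Pt d)) (z : Pt d) :
    ∑ j, (inner ℝ (stdOrthonormalBasis ℝ V j : Pt d) z) ^ 2 = ‖V.starProjection z‖ ^ 2 := by
  have h := (stdOrthonormalBasis ℝ V).sum_sq_norm_inner_right (V.orthogonalProjectionOnto z)
  rw [Submodule.coe_norm] at h
  rw [Submodule.starProjection_apply, ← h]
  refine Finset.sum_congr rfl fun j _ => ?_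
  rw [Real.norm_eq_abs, sq_abs, Submodule.coe_inner, ← Submodule.starProjection_apply,
    ← Submodule.inner_starProjection_left_eq_right,
    Submodule.starProjection_eq_self_iff.mpr (stdOrthonormalBasis ℝ V j).2]

/-- If a point `y` is closer to `V` than to the projection of `V` onto `H`, then adding `y` to `H`
decreases the residual of `V`. -/
theorem residual_add_sq_le (V : Submodule ℝ (Pt d)) {H H' : Submodule ℝ (Pt d)} (hH : H ≤ H')
    {y : Pt d} (hy : y ∈ H')
    (hG : 0 ≤ distTo y (V.map H.starProjection.toLinearMap) - distTo y V) :
    residual V H' + ((distTo y (V.map H.starProjection.toLinearMap) - distTo y V) / ‖y‖) ^ 2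
      ≤ residual V H := by
  set G := distTo y (V.map H.starProjection.toLinearMap) - distTo y V with hGdef
  rcases hG.eq_or_lt with hG0 | hG0
  · rw [← hG0]
    simpa using residual_anti V hH
  set v := V.starProjection y with hv
  set e := y - v with he
  set q := v - H.starProjection v with hq
  set z := y - H.starProjection y with hz
  have hvV : v ∈ V := V.starProjection_apply_mem y
  have hb : distTo y V = ‖e‖ := distTo_eq_norm y V
  have hD : ‖e‖ + G ≤ ‖e + q‖ := by
    have h1 : distTo y (V.map H.starProjection.toLinearMap) ≤ ‖y - H.starProjection v‖ :=
      distTo_le ⟨v, hvV, rfl⟩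
    have h2 : y - H.starProjection v = e + q := by rw [he, hq]; abel
    rw [h2] at h1
    linarith
  have hA : ‖e + q‖ ≤ ‖e‖ + ‖q‖ := norm_add_le e q
  have hqo : q ∈ Hᗮ := H.sub_starProjection_mem_orthogonal v
  have hzo : z ∈ Hᗮ := H.sub_starProjection_mem_orthogonal y
  have hev : inner ℝ e v = 0 :=
    Submodule.inner_left_of_mem_orthogonal hvV (V.sub_starProjection_mem_orthogonal y)
  have hzv : inner ℝ z v = ‖q‖ ^ 2 + inner ℝ e q := by
    have h1 : inner ℝ z v = inner ℝ z q := by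
      rw [hq, inner_sub_right,
        Submodule.inner_left_of_mem_orthogonal (H.starProjection_apply_mem v) hzo, sub_zero]
    have h2 : inner ℝ z q = inner ℝ y q := by
      rw [hz, inner_sub_left,
        Submodule.inner_right_of_mem_orthogonal (H.starProjection_apply_mem y) hqo, sub_zero]
    have h3 : inner ℝ v q = ‖q‖ ^ 2 := by
      have : v = q + H.starProjection v := by rw [hq]; abel
      nth_rewrite 1 [this]
      rw [inner_add_left,
        Submodule.inner_right_of_mem_orthogonal (H.starProjection_apply_mem v) hqo, add_zero,
        real_inner_self_eq_norm_sq]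
    have h4 : y = v + e := by rw [he]; abel
    rw [h1, h2, h4, inner_add_left, h3]
  have hzD : ‖z‖ ≤ ‖e + q‖ := by
    have h1 : z = (e + q) - H.starProjection (e + q) := by
      have h2 : e + q = y - H.starProjection v := by rw [he, hq]; abel
      rw [h2, map_sub,
        Submodule.starProjection_eq_self_iff.mpr (H.starProjection_apply_mem v), hz]
      abel
    rw [h1, ← distTo_eq_norm]
    exact distTo_le_norm _ _
  have hsq : ‖e + q‖ ^ 2 = ‖e‖ ^ 2 + 2 * inner ℝ e q + ‖q‖ ^ 2 := norm_add_sq_real e q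
  have hDpos : 0 < ‖e + q‖ := by linarith [norm_nonneg e]
  -- With `D = ‖e + q‖`, the inner product is `(D² - ‖e‖² + ‖q‖²) / 2`. As `0 ≤ D - ‖e‖ ≤ ‖q‖`, this
  -- is at least `D (D - ‖e‖) ≥ D G`.
  have hkey : G * ‖e + q‖ ≤ inner ℝ z v := by
    have hg : G ≤ ‖e + q‖ - ‖e‖ := by linarith
    have h1 : (‖e + q‖ - ‖e‖) ^ 2 ≤ ‖q‖ ^ 2 :=
      pow_le_pow_left₀ (by linarith) (by linarith) 2
    have h2 : G * ‖e + q‖ ≤ (‖e + q‖ - ‖e‖) * ‖e + q‖ :=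
      mul_le_mul_of_nonneg_right hg hDpos.le
    rw [hzv]
    nlinarith
  have hz0 : z ≠ 0 := by
    intro h0
    rw [h0, inner_zero_left] at hkey
    linarith [mul_pos hG0 hDpos]
  have hzn : 0 < ‖z‖ := norm_pos_iff.mpr hz0
  have hvy : ‖v‖ ≤ ‖y‖ := V.norm_starProjection_apply_le y
  -- The direction `z` that `H'` gains over `H` has a share of at least `G / ‖y‖` of its length in
  -- `V`.
  have hproj : G * ‖z‖ ≤ ‖V.starProjection z‖ * ‖y‖ := by
    calc G * ‖z‖ ≤ G * ‖e + q‖ := mul_le_mul_of_nonneg_left hzD hG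
      _ ≤ inner ℝ z v := hkey
      _ = inner ℝ (V.starProjection z) v := by
        rw [Submodule.inner_starProjection_left_eq_right,
          Submodule.starProjection_eq_self_iff.mpr hvV]
      _ ≤ ‖V.starProjection z‖ * ‖v‖ := real_inner_le_norm _ _
      _ ≤ ‖V.starProjection z‖ * ‖y‖ := mul_le_mul_of_nonneg_left hvy (norm_nonneg _)
  have hyn : 0 < ‖y‖ := by
    rcases (norm_nonneg y).eq_or_lt with h | h
    · rw [← h, mul_zero] at hproj
      linarith [mul_pos hG0 hzn]
    · exact h
  have hratio : (G / ‖y‖) ^ 2 ≤ ‖V.starProjection z‖ ^ 2 / ‖z‖ ^ 2 := by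
    rw [← div_pow]
    refine pow_le_pow_left₀ (by positivity) ?_ 2
    rwa [div_le_div_iff₀ hyn hzn]
  have hzH' : z ∈ H' := H'.sub_mem hy (hH (H.starProjection_apply_mem y))
  calc residual V H' + (G / ‖y‖) ^ 2
      ≤ residual V H' + ‖V.starProjection z‖ ^ 2 / ‖z‖ ^ 2 := by gcongr
    _ = ∑ j, (distTo (stdOrthonormalBasis ℝ V j : Pt d) H' ^ 2
          + (inner ℝ (stdOrthonormalBasis ℝ V j : Pt d) z) ^ 2 / ‖z‖ ^ 2) := by
        rw [Finset.sum_add_distrib, ← Finset.sum_div, sum_sq_inner_stdOrthonormalBasis]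
        rfl
    _ ≤ residual V H := Finset.sum_le_sum fun j _ => sq_distTo_add_le hH hzH' hzo hz0 _

/-- Bernoulli's inequality at `b / a`. It is applied with `c = ‖x i‖`, where the factor `c ^ (p -
1)` is the sampling weight divided by `‖x i‖`. -/
theorem rpow_sub_rpow_le {a b c p : ℝ} (hp : 1 ≤ p) (hb : 0 ≤ b) (hba : b ≤ a) (hac : a ≤ c) :
    a ^ p - b ^ p ≤ p * c ^ (p - 1) * (a - b) := by
  rcases (hb.trans hba).eq_or_lt with h0 | ha
  · have : b = a := le_antisymm hba (h0 ▸ hb)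
    simp [this]
  have h1 : 1 + p * (b / a - 1) ≤ (b / a) ^ p := by
    have := one_add_mul_self_le_rpow_one_add (s := b / a - 1)
      (by linarith [div_nonneg hb ha.le]) hp
    simpa using this
  rw [Real.div_rpow hb ha.le, le_div_iff₀ (Real.rpow_pos_of_pos ha p)] at h1
  have h2 : a ^ p = a ^ (p - 1) * a := by
    rw [← Real.rpow_add_one ha.ne', sub_add_cancel]
  have h3 : p * (b / a - 1) * a ^ p = p * a ^ (p - 1) * (b - a) := by
    rw [h2]
    field_simp
  have h4 : a ^ (p - 1) ≤ c ^ (p - 1) := Real.rpow_le_rpow ha.le hac (by linarith)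
  have h5 : p * a ^ (p - 1) * (a - b) ≤ p * c ^ (p - 1) * (a - b) :=
    mul_le_mul_of_nonneg_right (mul_le_mul_of_nonneg_left h4 (by linarith)) (by linarith)
  nlinarith

/-! ### Potential argument for independent draws -/

/-- If every draw made in a bad state decreases a potential by `c` on average, then the bad states
become unlikely. -/
theorem iid_potential {ι : Type} [Fintype ι] [DecidableEq ι] (q : PMF ι) (Φ : Finset ι → ENNReal)
    (B : Set (Finset ι)) (c : ENNReal) (hB : ∀ S i, insert i S ∈ B → S ∈ B)
    (h : ∀ S ∈ B, c + ∑ i, q i * Φ (insert i S) ≤ Φ S) (N : ℕ) (S : Finset ι) :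
    N * c * ∑ f : Fin N → ι, (∏ j, q (f j)) * B.indicator 1 (S ∪ Finset.univ.image f) ≤ Φ S := by
  have hq : ∑ i, q i = 1 := by simpa [tsum_fintype] using q.tsum_coe
  induction N generalizing S with
  | zero => simp
  | succ N ih =>
    set P : Finset ι → ENNReal := fun S =>
      ∑ f : Fin N → ι, (∏ j, q (f j)) * B.indicator 1 (S ∪ Finset.univ.image f) with hP
    have hstep : ∑ f : Fin (N + 1) → ι, (∏ j, q (f j)) * B.indicator 1 (S ∪ Finset.univ.image f)
        = ∑ i, q i * P (insert i S) := by
      rw [← (Fin.consEquiv (fun _ : Fin (N + 1) => ι)).sum_comp, Fintype.sum_prod_type]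
      refine Finset.sum_congr rfl fun i _ => ?_
      rw [hP, Finset.mul_sum]
      refine Finset.sum_congr rfl fun f _ => ?_
      have : Finset.univ.image (Fin.cons i f : Fin (N + 1) → ι)
          = insert i (Finset.univ.image f) := by
        ext a
        simp [Fin.exists_fin_succ, eq_comm]
      simp only [Fin.consEquiv, Equiv.coe_fn_mk, Fin.prod_univ_succ, Fin.cons_zero, Fin.cons_succ]
      rw [this, Finset.union_insert, Finset.insert_union, mul_assoc]
    rw [hstep]
    by_cases hS : S ∈ B
    · have hP1 : ∀ S, P S ≤ 1 := by
        intro S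
        calc P S ≤ ∑ f : Fin N → ι, iid q N f := by
              refine Finset.sum_le_sum fun f _ => ?_
              calc (∏ j, q (f j)) * B.indicator 1 (S ∪ Finset.univ.image f)
                  ≤ (∏ j, q (f j)) * 1 := by
                    gcongr
                    exact Set.indicator_le_self' (fun _ _ => zero_le) _
                _ = iid q N f := by rw [mul_one]; rfl
          _ = 1 := by simpa [tsum_fintype] using (iid q N).tsum_coe
      -- Of the `N + 1` copies of `c`, one is paid by the drop at the first draw and `N` by
      -- induction from `insert i S`.
      calc ((N + 1 : ℕ) : ENNReal) * c * ∑ i, q i * P (insert i S)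
          = c * ∑ i, q i * P (insert i S) + ∑ i, q i * (N * c * P (insert i S)) := by
            push_cast
            rw [show (∑ i, q i * (N * c * P (insert i S)))
                = N * c * ∑ i, q i * P (insert i S) by
              rw [Finset.mul_sum]
              exact Finset.sum_congr rfl fun i _ => by ring]
            ring
        _ ≤ c * ∑ i, q i * 1 + ∑ i, q i * Φ (insert i S) := by
            gcongr with i _ i _
            · exact hP1 _
            · exact ih _
        _ = c + ∑ i, q i * Φ (insert i S) := by simp [hq]
        _ ≤ Φ S := h S hS
    · have hun : ∀ T S, S ∉ B → S ∪ T ∉ B := by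
        intro T
        induction T using Finset.induction_on with
        | empty => simp
        | insert a T _ ihT =>
          intro S hS h'
          rw [Finset.union_insert] at h'
          exact ihT S hS (hB _ _ h')
      have h0 : ∀ i, P (insert i S) = 0 := fun i =>
        Finset.sum_eq_zero fun f _ => by
          rw [Set.indicator_of_notMem (hun _ _ fun h' => hS (hB _ _ h')), mul_zero]
      simp [h0]

/-! ### Approximating subspaces in the span of the sample -/

/-- The span of `S` contains a subspace of dimension at most `k` whose error over `I` exceeds that
of `V` by at most `ε ∑ i, ‖x i‖ ^ p`. -/
def Approximates (x : Fin n → Pt d) (k : ℕ) (p ε : ℝ) (V : Submodule ℝ (Pt d))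
    (I S : Finset (Fin n)) : Prop :=
  ∃ W : Submodule ℝ (Pt d), W ≤ spanOf x S ∧ Module.finrank ℝ W ≤ k ∧
    lpError x p W I ≤ lpError x p V I + ε * ∑ i, ‖x i‖ ^ p

theorem spanOf_mono (x : Fin n → Pt d) {S T : Finset (Fin n)} (h : S ⊆ T) :
    spanOf x S ≤ spanOf x T :=
  Submodule.span_mono (Set.image_mono (by exact_mod_cast h))

theorem mem_spanOf (x : Fin n → Pt d) {S : Finset (Fin n)} {i : Fin n} (h : i ∈ S) :
    x i ∈ spanOf x S :=
  Submodule.subset_span ⟨i, h, rfl⟩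

theorem spanOf_le_span_range (x : Fin n → Pt d) (S : Finset (Fin n)) :
    spanOf x S ≤ Submodule.span ℝ (Set.range x) :=
  Submodule.span_mono (Set.image_subset_range _ _)

theorem Approximates.mono {x : Fin n → Pt d} {k : ℕ} {p ε : ℝ} {V : Submodule ℝ (Pt d)}
    {I S T : Finset (Fin n)} (h : Approximates x k p ε V I S) (hST : S ⊆ T) :
    Approximates x k p ε V I T := by
  obtain ⟨W, h1, h2⟩ := h
  exact ⟨W, h1.trans (spanOf_mono x hST), h2⟩

theorem lpError_anti (x : Fin n → Pt d) {p : ℝ} (hp : 0 ≤ p) {V W : Submodule ℝ (Pt d)}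
    (h : V ≤ W) (I : Finset (Fin n)) : lpError x p W I ≤ lpError x p V I :=
  Finset.sum_le_sum fun _ _ => Real.rpow_le_rpow (distTo_nonneg _ _) (distTo_anti h _) hp

theorem exists_finrank_eq_of_le {W U : Submodule ℝ (Pt d)} (hWU : W ≤ U) {m : ℕ}
    (h1 : Module.finrank ℝ W ≤ m) (h2 : m ≤ Module.finrank ℝ U) :
    ∃ W' : Submodule ℝ (Pt d), W ≤ W' ∧ W' ≤ U ∧ Module.finrank ℝ W' = m := by
  induction m, h1 using Nat.le_induction with
  | base => exact ⟨W, le_rfl, hWU, rfl⟩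
  | succ m _ ih =>
    obtain ⟨W', hW, hU, hm⟩ := ih (by omega)
    have hnot : ¬ U ≤ W' := fun h => by
      have := Submodule.finrank_mono h
      omega
    obtain ⟨u, huU, huW⟩ := SetLike.not_le_iff_exists.mp hnot
    have hu : u ∈ W' ⊔ Submodule.span ℝ {u} :=
      le_sup_right (α := Submodule ℝ (Pt d)) (Submodule.mem_span_singleton_self u)
    refine ⟨W' ⊔ Submodule.span ℝ {u}, hW.trans le_sup_left,
      sup_le hU ((Submodule.span_singleton_le_iff_mem _ _).mpr huU), le_antisymm ?_ ?_⟩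
    · have h3 := Submodule.finrank_add_le_finrank_add_finrank W' (Submodule.span ℝ {u})
      have h4 : Module.finrank ℝ (Submodule.span ℝ {u}) ≤ 1 := by
        simpa using finrank_span_le_card (R := ℝ) ({u} : Set (Pt d))
      omega
    · have h3 : W' < W' ⊔ Submodule.span ℝ {u} :=
        lt_of_le_of_ne le_sup_left fun h => huW (h ▸ hu)
      have := Submodule.finrank_lt_finrank_of_lt h3
      omega

theorem Approximates.isGood {x : Fin n → Pt d} {k : ℕ} {p ε : ℝ} {V : Submodule ℝ (Pt d)}
    {I S : Finset (Fin n)} (h : Approximates x k p ε V I S) (hp : 0 ≤ p)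
    (hS : min k (Module.finrank ℝ (Submodule.span ℝ (Set.range x)))
      ≤ Module.finrank ℝ (spanOf x S)) : IsGood x k p ε V I S := by
  obtain ⟨W, hW, hWk, hWe⟩ := h
  obtain ⟨W', h1, h2, h3⟩ := exists_finrank_eq_of_le hW
    (le_min hWk (Submodule.finrank_mono (hW.trans (spanOf_le_span_range x S)))) hS
  exact ⟨W', h2, h3, (lpError_anti x hp h1 I).trans hWe⟩

/-- The projection `W` of `V` has excess error above `ε T`. Linearizing the `p`-th powers makes the
weighted mean of the relative gaps `G i / ‖x i‖` at least `ε / p`. Each draw lowers the residual by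
the square of its relative gap. -/
theorem residual_drop (x : Fin n → Pt d) {k : ℕ} {p ε : ℝ} {V : Submodule ℝ (Pt d)}
    {I S : Finset (Fin n)} (hp : 1 ≤ p) (hε : 0 < ε) (hV : Module.finrank ℝ V ≤ k)
    (hT : 0 < ∑ i, ‖x i‖ ^ p) (hS : ¬ Approximates x k p ε V I S) :
    (ε / p) ^ 2 + ∑ i, ‖x i‖ ^ p / (∑ i, ‖x i‖ ^ p) * residual V (spanOf x (insert i S))
      ≤ residual V (spanOf x S) := by
  have hp0 : 0 < p := by linarith
  set T := ∑ i, ‖x i‖ ^ p with hTdef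
  set W := V.map (spanOf x S).starProjection.toLinearMap with hWdef
  have hW : W ≤ spanOf x S := by
    rintro _ ⟨v, _, rfl⟩
    exact Submodule.starProjection_apply_mem _ v
  have hWk : Module.finrank ℝ W ≤ k := (Submodule.finrank_map_le _ _).trans hV
  have herr : lpError x p V I + ε * T < lpError x p W I := by
    by_contra h
    exact hS ⟨W, hW, hWk, not_lt.mp h⟩
  set G : Fin n → ℝ := fun i => max 0 (distTo (x i) W - distTo (x i) V) with hG
  set w : Fin n → ℝ := fun i => ‖x i‖ ^ p / T with hw
  have hw0 : ∀ i, 0 ≤ w i := fun i => div_nonneg (Real.rpow_nonneg (norm_nonneg _) _) hT.le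
  have hw1 : ∑ i, w i = 1 := by rw [← Finset.sum_div, ← hTdef, div_self hT.ne']
  have hG0 : ∀ i, 0 ≤ G i := fun i => le_max_left _ _
  have hterm : ∀ i, distTo (x i) W ^ p - distTo (x i) V ^ p ≤ p * T * (w i * (G i / ‖x i‖)) := by
    intro i
    have hr : 0 ≤ p * T * (w i * (G i / ‖x i‖)) :=
      mul_nonneg (mul_nonneg hp0.le hT.le)
        (mul_nonneg (hw0 i) (div_nonneg (hG0 i) (norm_nonneg _)))
    rcases le_total (distTo (x i) W) (distTo (x i) V) with hle | hle
    · have := Real.rpow_le_rpow (distTo_nonneg _ _) hle hp0.le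
      linarith
    · rcases (norm_nonneg (x i)).eq_or_lt with hx | hx
      · have h1 := distTo_le_norm (x i) W
        rw [← hx] at h1
        have h2 : distTo (x i) W = distTo (x i) V :=
          le_antisymm (h1.trans (distTo_nonneg _ _)) hle
        rw [h2, sub_self]
        exact hr
      · have h1 := rpow_sub_rpow_le hp (distTo_nonneg (x i) V) hle (distTo_le_norm (x i) W)
        have h2 : G i = distTo (x i) W - distTo (x i) V := max_eq_right (by linarith)
        have h3 : ‖x i‖ ^ p = ‖x i‖ ^ (p - 1) * ‖x i‖ := by
          rw [← Real.rpow_add_one hx.ne', sub_add_cancel]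
        refine h1.trans_eq ?_
        rw [← h2]
        simp only [hw, h3]
        field_simp
  have hmean : ε / p ≤ ∑ i, w i * (G i / ‖x i‖) := by
    have h1 : ε * T ≤ p * T * ∑ i, w i * (G i / ‖x i‖) := by
      calc ε * T ≤ ∑ i ∈ I, (distTo (x i) W ^ p - distTo (x i) V ^ p) := by
            rw [Finset.sum_sub_distrib]
            unfold lpError at herr
            linarith
        _ ≤ ∑ i ∈ I, p * T * (w i * (G i / ‖x i‖)) := Finset.sum_le_sum fun i _ => hterm i
        _ ≤ ∑ i, p * T * (w i * (G i / ‖x i‖)) :=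
            Finset.sum_le_sum_of_subset_of_nonneg (Finset.subset_univ _) fun i _ _ =>
              mul_nonneg (mul_nonneg hp0.le hT.le)
                (mul_nonneg (hw0 i) (div_nonneg (hG0 i) (norm_nonneg _)))
        _ = p * T * ∑ i, w i * (G i / ‖x i‖) := (Finset.mul_sum _ _ _).symm
    rw [div_le_iff₀ hp0]
    exact le_of_mul_le_mul_right (by linarith) hT
  -- Jensen for the square.
  have hsq : (ε / p) ^ 2 ≤ ∑ i, w i * (G i / ‖x i‖) ^ 2 :=
    (pow_le_pow_left₀ (by positivity) hmean 2).trans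
      (Real.pow_arith_mean_le_arith_mean_pow _ _ _ (fun i _ => hw0 i) hw1
        (fun i _ => div_nonneg (hG0 i) (norm_nonneg _)) 2)
  have hdrop : ∀ i, residual V (spanOf x (insert i S)) + (G i / ‖x i‖) ^ 2
      ≤ residual V (spanOf x S) := by
    intro i
    have hsub := spanOf_mono x (Finset.subset_insert i S)
    rcases le_total (distTo (x i) W - distTo (x i) V) 0 with hle | hle
    · have : G i = 0 := max_eq_left hle
      rw [this]
      simpa using residual_anti V hsub
    · have : G i = distTo (x i) W - distTo (x i) V := max_eq_right hle
      rw [this]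
      exact residual_add_sq_le V hsub (mem_spanOf x (Finset.mem_insert_self i S)) hle
  calc (ε / p) ^ 2 + ∑ i, w i * residual V (spanOf x (insert i S))
      ≤ ∑ i, w i * (residual V (spanOf x (insert i S)) + (G i / ‖x i‖) ^ 2) := by
        simp only [mul_add, Finset.sum_add_distrib]
        linarith
    _ ≤ ∑ i, w i * residual V (spanOf x S) :=
        Finset.sum_le_sum fun i _ => mul_le_mul_of_nonneg_left (hdrop i) (hw0 i)
    _ = residual V (spanOf x S) := by rw [← Finset.sum_mul, hw1, one_mul]

/-! ### The first round finds an approximating subspace -/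

theorem weight_eq_zero_iff {x : Fin n → Pt d} {p : ℝ} (hp : 0 < p) {S : Finset (Fin n)}
    {i : Fin n} : weight x p S i = 0 ↔ x i ∈ spanOf x S := by
  rw [weight, ENNReal.ofReal_eq_zero, ← distTo_eq_zero_iff]
  constructor
  · intro h
    exact ((Real.rpow_eq_zero (distTo_nonneg _ _) hp.ne').mp
      (h.antisymm (Real.rpow_nonneg (distTo_nonneg _ _) _)))
  · intro h
    rw [h, Real.zero_rpow hp.ne']

theorem weight_empty (x : Fin n → Pt d) (p : ℝ) (i : Fin n) :
    weight x p ∅ i = ENNReal.ofReal (‖x i‖ ^ p) := by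
  simp [weight, spanOf, distTo_bot]

theorem round_not_approximates_le (x : Fin n → Pt d) {k N : ℕ} {p ε : ℝ}
    {V : Submodule ℝ (Pt d)} {I : Finset (Fin n)} (hk : 1 ≤ k) (hp : 1 ≤ p) (hε : 0 < ε)
    (hV : Module.finrank ℝ V = k) (hN : 2 * k ≤ N * (ε / p) ^ 2) :
    (round x p N ∅).toOuterMeasure {S | ¬ Approximates x k p ε V I S} ≤ 2⁻¹ := by
  classical
  have hp0 : 0 < p := by linarith
  have hTn : ∀ i, 0 ≤ ‖x i‖ ^ p := fun i => Real.rpow_nonneg (norm_nonneg _) _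
  have hsum : ∑' i, weight x p ∅ i = ENNReal.ofReal (∑ i, ‖x i‖ ^ p) := by
    rw [tsum_fintype, ENNReal.ofReal_sum_of_nonneg fun i _ => hTn i]
    exact Finset.sum_congr rfl fun i _ => weight_empty x p i
  by_cases h : ∑' i, weight x p ∅ i = 0
  -- All points are `0`, so the zero subspace has no error.
  · have hA : Approximates x k p ε V I ∅ := by
      refine ⟨⊥, bot_le, by simp, ?_⟩
      have h0 : ∀ i, ‖x i‖ ^ p = 0 := fun i => by
        have h1 := (ENNReal.tsum_eq_zero.mp h) i
        rw [weight_empty, ENNReal.ofReal_eq_zero] at h1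
        exact h1.antisymm (hTn i)
      have h1 : lpError x p ⊥ I = 0 :=
        Finset.sum_eq_zero fun i _ => by rw [distTo_bot, h0]
      rw [h1]
      exact add_nonneg (Finset.sum_nonneg fun i _ => Real.rpow_nonneg (distTo_nonneg _ _) _)
        (mul_nonneg hε.le (Finset.sum_nonneg fun i _ => hTn i))
    rw [round, dif_pos h, PMF.toOuterMeasure_pure_apply, if_neg (by simpa using hA)]
    exact zero_le
  · have hT : 0 < ∑ i, ‖x i‖ ^ p := by
      rw [hsum, ENNReal.ofReal_eq_zero, not_le] at h
      exact h
    set q := PMF.normalize (weight x p ∅) h (tsum_weight_ne_top x p ∅) with hq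
    set B : Set (Finset (Fin n)) := {S | ¬ Approximates x k p ε V I S} with hB
    have hqi : ∀ i, q i = ENNReal.ofReal (‖x i‖ ^ p / ∑ i, ‖x i‖ ^ p) := fun i => by
      rw [hq, PMF.normalize_apply, hsum, weight_empty, ENNReal.ofReal_div_of_pos hT,
        div_eq_mul_inv]
    have hpot := iid_potential q (fun S => ENNReal.ofReal (residual V (spanOf x S))) B
      (ENNReal.ofReal ((ε / p) ^ 2))
      (fun S i hi hA => hi (hA.mono (Finset.subset_insert i S))) (by
        intro S hS
        have hd := residual_drop x hp hε hV.le hT hS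
        have hnn : ∀ i, 0 ≤ ‖x i‖ ^ p / (∑ i, ‖x i‖ ^ p)
            * residual V (spanOf x (insert i S)) := fun i =>
          mul_nonneg (div_nonneg (hTn i) hT.le) (residual_nonneg _ _)
        refine le_trans (le_of_eq ?_) (ENNReal.ofReal_le_ofReal hd)
        rw [ENNReal.ofReal_add (sq_nonneg _) (Finset.sum_nonneg fun i _ => hnn i),
          ENNReal.ofReal_sum_of_nonneg fun i _ => hnn i]
        congr 1
        refine Finset.sum_congr rfl fun i _ => ?_
        rw [hqi, ENNReal.ofReal_mul (div_nonneg (hTn i) hT.le)]) N ∅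
    have hprob : (round x p N ∅).toOuterMeasure B
        = ∑ f : Fin N → Fin n, (∏ j, q (f j)) * B.indicator 1 (∅ ∪ Finset.univ.image f) := by
      rw [round, dif_neg h, PMF.toOuterMeasure_map_apply, PMF.toOuterMeasure_apply_fintype]
      refine Finset.sum_congr rfl fun f _ => ?_
      rw [Set.indicator_apply, Set.indicator_apply]
      simp only [Set.mem_preimage, Pi.one_apply, mul_ite, mul_one, mul_zero]
      congr
    rw [← hprob] at hpot
    have hk0 : (k : ENNReal) ≠ 0 := by
      simpa using (by omega : k ≠ 0)
    have hle : (k : ENNReal) * (2 * (round x p N ∅).toOuterMeasure B) ≤ k * 1 := by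
      calc (k : ENNReal) * (2 * (round x p N ∅).toOuterMeasure B)
          = ENNReal.ofReal (2 * k) * (round x p N ∅).toOuterMeasure B := by
            rw [ENNReal.ofReal_mul zero_le_two, ENNReal.ofReal_natCast, ENNReal.ofReal_ofNat]
            ring
        _ ≤ ENNReal.ofReal (N * (ε / p) ^ 2) * (round x p N ∅).toOuterMeasure B := by
            gcongr
        _ = N * ENNReal.ofReal ((ε / p) ^ 2) * (round x p N ∅).toOuterMeasure B := by
            rw [ENNReal.ofReal_mul (Nat.cast_nonneg _), ENNReal.ofReal_natCast]
        _ ≤ ENNReal.ofReal (residual V (spanOf x ∅)) := hpot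
        _ ≤ ENNReal.ofReal k :=
            ENNReal.ofReal_le_ofReal (hV ▸ residual_le_finrank V _)
        _ = k * 1 := by simp
    rw [ENNReal.mul_le_mul_iff_right hk0 (ENNReal.natCast_ne_top k), mul_comm] at hle
    rw [← one_div]
    exact (ENNReal.le_div_iff_mul_le (by simp) (by simp)).mpr hle

/-! ### Later rounds: growth of the rank and persistence of success -/

theorem subset_of_mem_support_round {x : Fin n → Pt d} {p : ℝ} {N : ℕ} {S S' : Finset (Fin n)}
    (h : S' ∈ (round x p N S).support) : S ⊆ S' := by
  classical
  rw [round] at h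
  split_ifs at h with h0
  · rw [PMF.mem_support_pure_iff] at h
    exact h.ge
  · obtain ⟨f, _, rfl⟩ := (PMF.mem_support_map_iff _ _ _).mp h
    exact Finset.subset_union_left

/-- Points already in the span have weight `0`, so any draw of positive probability leaves the span;
no draw is made only when the span contains all points. -/
theorem min_le_finrank_of_mem_support_round {x : Fin n → Pt d} {p : ℝ} {N : ℕ} (hp : 0 < p)
    (hN : 0 < N) {S S' : Finset (Fin n)} (h : S' ∈ (round x p N S).support) :
    min (Module.finrank ℝ (spanOf x S) + 1) (Module.finrank ℝ (Submodule.span ℝ (Set.range x)))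
      ≤ Module.finrank ℝ (spanOf x S') := by
  classical
  rw [round] at h
  split_ifs at h with h0
  · rw [PMF.mem_support_pure_iff] at h
    subst h
    refine (min_le_right _ _).trans (Submodule.finrank_mono (Submodule.span_le.mpr ?_))
    rintro _ ⟨i, rfl⟩
    exact (weight_eq_zero_iff hp).mp (ENNReal.tsum_eq_zero.mp h0 i)
  · obtain ⟨f, hf, rfl⟩ := (PMF.mem_support_map_iff _ _ _).mp h
    set i := f ⟨0, hN⟩ with hi
    have hprod : ∏ j, PMF.normalize (weight x p S) h0 (tsum_weight_ne_top x p S) (f j) ≠ 0 :=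
      (PMF.mem_support_iff _ _).mp hf
    have hfi : PMF.normalize (weight x p S) h0 (tsum_weight_ne_top x p S) i ≠ 0 :=
      Finset.prod_ne_zero_iff.mp hprod ⟨0, hN⟩ (Finset.mem_univ _)
    have hwi := (PMF.mem_support_normalize_iff _ _ i).mp ((PMF.mem_support_iff _ _).mpr hfi)
    have hxi : x i ∉ spanOf x S := fun h' => hwi ((weight_eq_zero_iff hp).mpr h')
    refine (min_le_left _ _).trans (Submodule.finrank_lt_finrank_of_lt
      (lt_of_le_of_ne (spanOf_mono x Finset.subset_union_left) fun h' => hxi ?_))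
    rw [h']
    exact mem_spanOf x (Finset.mem_union_right _ (Finset.mem_image_of_mem _ (Finset.mem_univ _)))

theorem min_le_finrank_of_mem_support_adaptiveSample {x : Fin n → Pt d} {p : ℝ} {N : ℕ}
    (hp : 0 < p) (hN : 0 < N) (t : ℕ) {S : Finset (Fin n)}
    (h : S ∈ (adaptiveSample x p N t).support) :
    min t (Module.finrank ℝ (Submodule.span ℝ (Set.range x)))
      ≤ Module.finrank ℝ (spanOf x S) := by
  induction t generalizing S with
  | zero => simp
  | succ t ih =>
    rw [adaptiveSample, PMF.mem_support_bind_iff] at h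
    obtain ⟨S₀, h1, h2⟩ := h
    have h3 := ih h1
    have h4 := min_le_finrank_of_mem_support_round hp hN h2
    omega

theorem adaptiveSample_not_approximates_le (x : Fin n → Pt d) {k N : ℕ} {p ε : ℝ}
    {V : Submodule ℝ (Pt d)} {I : Finset (Fin n)} (hk : 1 ≤ k) (hp : 1 ≤ p) (hε : 0 < ε)
    (hV : Module.finrank ℝ V = k) (hN : 2 * k ≤ N * (ε / p) ^ 2) {t : ℕ} (ht : 1 ≤ t) :
    (adaptiveSample x p N t).toOuterMeasure {S | ¬ Approximates x k p ε V I S} ≤ 2⁻¹ := by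
  induction t, ht using Nat.le_induction with
  | base =>
    simp only [adaptiveSample, PMF.pure_bind]
    exact round_not_approximates_le x hk hp hε hV hN
  | succ t _ ih =>
    refine le_trans ?_ ih
    rw [adaptiveSample, PMF.toOuterMeasure_bind_apply, PMF.toOuterMeasure_apply]
    refine ENNReal.tsum_le_tsum fun S => ?_
    by_cases hS : Approximates x k p ε V I S
    · have : (round x p N S).toOuterMeasure {S | ¬ Approximates x k p ε V I S} = 0 := by
        rw [PMF.toOuterMeasure_apply_eq_zero_iff, Set.disjoint_left]
        intro S' h1 h2
        exact h2 (hS.mono (subset_of_mem_support_round h1))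
      rw [this, mul_zero]
      exact zero_le
    · rw [Set.indicator_of_mem (by exact hS)]
      refine mul_le_of_le_one_right' ?_
      rw [← (PMF.toOuterMeasure_apply_eq_one_iff _ Set.univ).mpr (Set.subset_univ _)]
      exact MeasureTheory.measure_mono (Set.subset_univ _)

theorem half_le_adaptiveSample_isGood (x : Fin n → Pt d) {k N : ℕ} {p ε : ℝ}
    {V : Submodule ℝ (Pt d)} {I : Finset (Fin n)} (hk : 1 ≤ k) (hp : 1 ≤ p) (hε : 0 < ε)
    (hV : Module.finrank ℝ V = k) (hN : 2 * k ≤ N * (ε / p) ^ 2) :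
    2⁻¹ ≤ (adaptiveSample x p N k).toOuterMeasure {S | IsGood x k p ε V I S} := by
  have hp0 : 0 < p := by linarith
  have hN0 : 0 < N := by
    rcases Nat.eq_zero_or_pos N with h | h
    · have hk' : (1 : ℝ) ≤ k := by exact_mod_cast hk
      rw [h] at hN
      simp only [Nat.cast_zero, zero_mul] at hN
      linarith
    · exact h
  set μ := adaptiveSample x p N k
  set B := {S | ¬ Approximates x k p ε V I S} with hB
  have h1 : μ.toOuterMeasure Bᶜ ≤ μ.toOuterMeasure {S | IsGood x k p ε V I S} :=
    -- The inclusion is needed only on the support, where the rank bound holds.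
    PMF.toOuterMeasure_mono _ fun S hS =>
      (not_not.mp hS.1).isGood hp0.le
        (min_le_finrank_of_mem_support_adaptiveSample hp0 hN0 k hS.2)
  have h2 : μ.toOuterMeasure B ≤ 2⁻¹ := adaptiveSample_not_approximates_le x hk hp hε hV hN hk
  have h3 : 1 ≤ μ.toOuterMeasure B + μ.toOuterMeasure Bᶜ := by
    rw [← (PMF.toOuterMeasure_apply_eq_one_iff μ Set.univ).mpr (Set.subset_univ _),
      ← Set.union_compl_self B]
    exact MeasureTheory.measure_union_le _ _
  have h4 : (2⁻¹ : ENNReal) + 2⁻¹ ≤ 2⁻¹ + μ.toOuterMeasure {S | IsGood x k p ε V I S} := by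
    rw [ENNReal.inv_two_add_inv_two]
    exact h3.trans (add_le_add h2 h1)
  exact (ENNReal.add_le_add_iff_left (by simp)).mp h4

/-! ### Constants and conclusion -/

theorem half_le_log_two_mul_div {k : ℕ} {ε : ℝ} (hk : 1 ≤ k) (hε : 0 < ε) (hε1 : ε < 1) :
    1 / 2 ≤ Real.log (2 * k / ε) := by
  have hk' : (1 : ℝ) ≤ k := by exact_mod_cast hk
  have h1 : (2 : ℝ) ≤ 2 * k / ε := by
    rw [le_div_iff₀ hε]
    nlinarith
  linarith [Real.log_le_log two_pos h1, Real.log_two_gt_d9]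

end SubspaceOutliers

end

theorem mainTheorem4 :
    ∃ C C' q : ℝ, 0 < C ∧ 0 < C' ∧ 0 < q ∧
      ∀ (n d k : ℕ) (p ε α : ℝ), 1 ≤ k → k ≤ d → 1 ≤ p → 0 < ε → ε < 1 → 0 ≤ α → α ≤ 1 →
        (k * SubspaceOutliers.roundSize C p k ε : ℝ)
            ≤ C' * (p ^ 2 * k ^ 2 / ε ^ 2 * Real.log (2 * k / ε)) ∧
        ∀ (x : Fin n → SubspaceOutliers.Pt d) (V : Submodule ℝ (SubspaceOutliers.Pt d))
          (I : Finset (Fin n)), SubspaceOutliers.IsOptimal x k p α V I →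
          ENNReal.ofReal q ≤
            (SubspaceOutliers.adaptiveSample x p (SubspaceOutliers.roundSize C p k ε) k).toOuterMeasure
              {S | SubspaceOutliers.IsGood x k p ε V I S} := by
  -- With `A = p² k / ε² ≥ 1` and logarithm `L ≥ 1/2`, `4 A L ≥ 2 A` is the number of draws
  -- required. Rounding up adds at most `1 ≤ 2 A L`, whence `6 = 4 + 2`.
  refine ⟨4, 6, 1 / 2, by norm_num, by norm_num, by norm_num, ?_⟩
  intro n d k p ε α hk _ hp hε hε1 _ _
  have hlog := SubspaceOutliers.half_le_log_two_mul_div hk hε hε1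
  have hk' : (1 : ℝ) ≤ k := by exact_mod_cast hk
  set A : ℝ := p ^ 2 * k / ε ^ 2 with hA
  have hA1 : 1 ≤ A := by
    rw [hA, le_div_iff₀ (by positivity), one_mul]
    have h1 : ε ^ 2 ≤ 1 := pow_le_one₀ hε.le hε1.le
    have h2 : 1 ≤ p ^ 2 := one_le_pow₀ hp
    nlinarith
  have hAL : A * (1 / 2) ≤ A * Real.log (2 * k / ε) :=
    mul_le_mul_of_nonneg_left hlog (by linarith)
  refine ⟨?_, fun x V I hopt => ?_⟩
  · have h1 : (SubspaceOutliers.roundSize 4 p k ε : ℝ) ≤ 6 * (A * Real.log (2 * k / ε)) := by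
      have := (Nat.ceil_lt_add_one (show 0 ≤ 4 * (A * Real.log (2 * k / ε)) by linarith)).le
      rw [SubspaceOutliers.roundSize]
      linarith
    calc (k * SubspaceOutliers.roundSize 4 p k ε : ℝ)
        ≤ k * (6 * (A * Real.log (2 * k / ε))) := mul_le_mul_of_nonneg_left h1 (by linarith)
      _ = 6 * (p ^ 2 * k ^ 2 / ε ^ 2 * Real.log (2 * k / ε)) := by
        rw [hA]
        ring
  · have hN : 2 * (k : ℝ) ≤ SubspaceOutliers.roundSize 4 p k ε * (ε / p) ^ 2 := by
      have h1 : 2 * A ≤ SubspaceOutliers.roundSize 4 p k ε := by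
        refine le_trans ?_ (Nat.le_ceil _)
        linarith
      calc 2 * (k : ℝ) = 2 * A * (ε / p) ^ 2 := by
            rw [hA]
            field_simp
        _ ≤ _ := mul_le_mul_of_nonneg_right h1 (sq_nonneg _)
    have h := SubspaceOutliers.half_le_adaptiveSample_isGood x (I := I) hk hp hε
      hopt.finrank_eq hN
    have hq : ENNReal.ofReal (1 / 2) = 2⁻¹ := by
      rw [one_div, ENNReal.ofReal_inv_of_pos two_pos, ENNReal.ofReal_ofNat]
    rwa [hq]
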